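/- Let $n\ge 5$ and let $A=(A_i)_{i\in\mathbb Z/n\mathbb Z}$, $A_i=(x_i,y_i)\in\mathbb R^2$, be the vertices, in cyclic order, of a (strictly) convex $n$-gon; that is, for every $i$ all vertices other than $A_i,A_{i+1}$ lie strictly on one and the same side of the line $A_iA_{i+1}$. The pentagram map $T$ sends $A$ to the polygon $T(A)$ whose $i$-th vertex is the intersection point of the diagonals $A_{i-1}A_{i+1}$ and $A_iA_{i+2}$. Put $u_i=(x_i,y_i,1)^{T}\in\mathbb R^3$, and let $L_A$ be the real $3\times 3$ matrix of the linear map $$L_A(v)=nv-\sum_{j=1}^{n}\frac{|u_{j-1},v,u_{j+1}|}{|u_{j-1},u_j,u_{j+1}|}\,u_j ,$$ where $|\cdot,\cdot,\cdot|$ is the determinant of three vectors and indices are taken modulo $n$. Then the iterates $T^k(A)$ converge, as $k\to\infty$, to a single point $(X,Y)\in\mathbb R^2$ (that is, for each $i$ the $i$-th vertex of $T^k(A)$ tends to $(X,Y)$), and the vector $(X,Y,1)^{T}$ is an eigenvector of $L_A$ with some real eigenvalue $\lambda$ such that, with $K=\mathbb Q(x_1,y_1,\dots,x_n,y_n)$,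 the field extension $K(\lambda)/K$ has degree at most $3$ and contains both $X$ and $Y$. -/

import Mathlib

noncomputable section

namespace Pentagram

/-- The lift `(x, y, 1) ∈ ℝ³` of the point `(x, y)` of the plane. -/
def lift (p : ℝ × ℝ) : Fin 3 → ℝ := ![p.1, p.2, 1]

/-- The determinant `|a, b, c|` of three vectors of `ℝ³`. -/
def det3 (a b c : Fin 3 → ℝ) : ℝ := Matrix.det (Matrix.of ![a, b, c])

/-- `orient p q r` is twice the signed area of the triangle `p q r`: it is positive, negative or
zero according to whether `r` lies to the left of, to the right of, or on the line from `p` to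
`q`. -/
def orient (p q r : ℝ × ℝ) : ℝ := det3 (lift p) (lift q) (lift r)

/-- `A` is the list of vertices, in cyclic order (of either orientation), of a convex `n`-gon:
all vertices other than the two ends of a side lie strictly on one side of the line that carries
that side. For `n ≥ 3` the vertices are then distinct, no three of them are collinear, and the
sides `A i, A (i + 1)` are the edges of the convex hull. -/
def IsConvexPolygon {n : ℕ} (A : ZMod n → ℝ × ℝ) : Prop :=
  (∀ i j : ZMod n, j ≠ i → j ≠ i + 1 → 0 < orient (A i) (A (i + 1)) (A j)) ∨
  (∀ i j : ZMod n, j ≠ i → j ≠ i + 1 → orient (A i) (A (i + 1)) (A j) < 0)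

/-- The intersection point of the lines `p q` and `r s`, meaningful when these are not parallel;
see `line_inf_line_eq`. -/
def lineInter (p q r s : ℝ × ℝ) : ℝ × ℝ :=
  AffineMap.lineMap p q (orient r s p / (orient r s p - orient r s q))

/-- The pentagram map `T`: the `i`-th vertex of `T A` is the intersection of the diagonals
`A (i - 1) A (i + 1)` and `A i A (i + 2)`. -/
def pentagramMap {n : ℕ} (A : ZMod n → ℝ × ℝ) : ZMod n → ℝ × ℝ :=
  fun i => lineInter (A (i - 1)) (A (i + 1)) (A i) (A (i + 2))

theorem orient_eq (p q r : ℝ × ℝ) :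
    orient p q r = (q.1 - p.1) * (r.2 - p.2) - (q.2 - p.2) * (r.1 - p.1) := by
  simp [orient, det3, lift, Matrix.det_fin_three]
  ring

/-- Unless the lines `p q` and `r s` are parallel, `lineInter p q r s` is their only common
point. -/
theorem line_inf_line_eq {p q r s : ℝ × ℝ} (h : orient r s p ≠ orient r s q) :
    ((affineSpan ℝ {p, q} : AffineSubspace ℝ (ℝ × ℝ)) : Set (ℝ × ℝ)) ∩
      (affineSpan ℝ {r, s} : AffineSubspace ℝ (ℝ × ℝ)) = {lineInter p q r s} := by
  have h' : orient r s p - orient r s q ≠ 0 := sub_ne_zero.mpr h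
  have key : ∀ t : ℝ, orient r s (AffineMap.lineMap p q t) =
      orient r s p - t * (orient r s p - orient r s q) := by
    intro t
    simp only [orient_eq, AffineMap.lineMap_apply, vsub_eq_sub, vadd_eq_add, Prod.fst_add,
      Prod.snd_add, Prod.smul_fst, Prod.smul_snd, Prod.fst_sub, Prod.snd_sub, smul_eq_mul]
    ring
  have mem_zero : ∀ x : ℝ × ℝ, x ∈ (affineSpan ℝ {r, s} : AffineSubspace ℝ (ℝ × ℝ)) →
      orient r s x = 0 := by
    intro x hx
    obtain ⟨t, rfl⟩ := mem_affineSpan_pair_iff_exists_lineMap_eq.mp hx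
    simp only [orient_eq, AffineMap.lineMap_apply, vsub_eq_sub, vadd_eq_add, Prod.fst_add,
      Prod.snd_add, Prod.smul_fst, Prod.smul_snd, Prod.fst_sub, Prod.snd_sub, smul_eq_mul]
    ring
  have zero_mem : ∀ x : ℝ × ℝ, orient r s x = 0 →
      x ∈ (affineSpan ℝ {r, s} : AffineSubspace ℝ (ℝ × ℝ)) := by
    intro x hx
    rw [mem_affineSpan_pair_iff_exists_lineMap_eq]
    rw [orient_eq] at hx
    by_cases h1 : s.1 - r.1 = 0
    · have h2 : s.2 - r.2 ≠ 0 := by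
        intro h2
        apply h
        simp [orient_eq, h1, h2]
      refine ⟨(x.2 - r.2) / (s.2 - r.2), ?_⟩
      apply Prod.ext
      · have : x.1 - r.1 = 0 := by
          rw [h1] at hx
          have h3 : (s.2 - r.2) * (x.1 - r.1) = 0 := by linarith
          exact (mul_eq_zero.mp h3).resolve_left h2
        simp [AffineMap.lineMap_apply, h1]
        linarith
      · simp [AffineMap.lineMap_apply]
        field_simp
        ring
    · refine ⟨(x.1 - r.1) / (s.1 - r.1), ?_⟩
      apply Prod.ext
      · simp [AffineMap.lineMap_apply]
        field_simp
        ring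
      · simp [AffineMap.lineMap_apply]
        field_simp
        linarith
  ext x
  simp only [Set.mem_inter_iff, SetLike.mem_coe, Set.mem_singleton_iff]
  constructor
  · rintro ⟨h1, h2⟩
    obtain ⟨t, rfl⟩ := mem_affineSpan_pair_iff_exists_lineMap_eq.mp h1
    have h3 := mem_zero _ h2
    rw [key] at h3
    unfold lineInter
    congr 1
    rw [eq_div_iff h']
    linarith
  · rintro rfl
    refine ⟨AffineMap.lineMap_mem_affineSpan_pair _ _ _, zero_mem _ ?_⟩
    unfold lineInter
    rw [key, div_mul_cancel₀ _ h', sub_self]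

/-- The linear map `L_A : ℝ³ → ℝ³`,
`L_A v = n v - ∑ⱼ (|uⱼ₋₁, v, uⱼ₊₁| / |uⱼ₋₁, uⱼ, uⱼ₊₁|) uⱼ`, where `uⱼ = (xⱼ, yⱼ, 1)`. -/
def glickMap {n : ℕ} [NeZero n] (A : ZMod n → ℝ × ℝ) : (Fin 3 → ℝ) →ₗ[ℝ] (Fin 3 → ℝ) where
  toFun v := (n : ℝ) • v - ∑ j : ZMod n,
    (det3 (lift (A (j - 1))) v (lift (A (j + 1))) /
      det3 (lift (A (j - 1))) (lift (A j)) (lift (A (j + 1)))) • lift (A j)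
  map_add' v w := by
    have h : ∀ a b : Fin 3 → ℝ, det3 a (v + w) b = det3 a v b + det3 a w b := by
      intro a b
      simp [det3, Matrix.det_fin_three]
      ring
    simp only [h, add_div, add_smul, Finset.sum_add_distrib, smul_add]
    abel
  map_smul' c v := by
    have h : ∀ a b : Fin 3 → ℝ, det3 a (c • v) b = c * det3 a v b := by
      intro a b
      simp [det3, Matrix.det_fin_three]
      ring
    simp only [h, mul_div_assoc, mul_smul, ← Finset.smul_sum, RingHom.id_apply, smul_sub]
    rw [smul_comm]

/-- The `3 × 3` matrix of `L_A` in the standard basis. -/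
def glickMatrix {n : ℕ} [NeZero n] (A : ZMod n → ℝ × ℝ) : Matrix (Fin 3) (Fin 3) ℝ :=
  LinearMap.toMatrix' (glickMap A)

/-- The field `ℚ(x₁, y₁, …, xₙ, yₙ)` generated by the coordinates of the vertices. -/
def coordField {n : ℕ} (A : ZMod n → ℝ × ℝ) : IntermediateField ℚ ℝ :=
  IntermediateField.adjoin ℚ (Set.range (fun i => (A i).1) ∪ Set.range (fun i => (A i).2))

end Pentagram

end

/-! Let G be the operator `glickMap A`. Everything rests on two properties of G.

It is invariant under the pentagram map (`IsPositive.glickMap_pentagramMap`): both operators,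
expanded in vertices of the new polygon, become the same sum after a shift of the index.

It is positive (`IsPositive.glickMap_eq`): G v is a combination of the lifted vertices, with
coefficients that are edge heights of v divided by ear areas, hence nonnegative for v in the cone
over the polygon.

Since lifts have last coordinate 1, the last coordinate of G v is the sum of these coefficients. By
invariance it is one fixed linear form, bounded on all iterates by its maximum on A. So edge heights
are at most a constant times ear areas, uniformly in k (`IsPositive.exists_shape_bound`). This
nondegeneracy makes the oscillation of each linear form decay geometrically, and the iterates
converge to a point p.

Written through a late iterate, G(p) is a nonnegative combination of vertices close to p; hence G(p)
is a multiple of p (`IsPositive.glickMap_limit`). A Perron–Frobenius argument shows that the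
eigenspace of p is a line. It is cut out by linear equations over K(λ), so p, with last coordinate
1, has its coordinates there; λ is a root of a cubic characteristic polynomial over K. -/

namespace Pentagram

open Filter Topology

/-! ### Determinants of three vectors and Cramer's rule. -/

section Det

theorem det3_eq (a b c : Fin 3 → ℝ) : det3 a b c =
    a 0 * (b 1 * c 2 - b 2 * c 1) - a 1 * (b 0 * c 2 - b 2 * c 0)
      + a 2 * (b 0 * c 1 - b 1 * c 0) := by
  simp [det3, Matrix.det_fin_three]
  ring

/-- The linear form `v ↦ |a, b, v|`. -/
noncomputable def detForm (a b : Fin 3 → ℝ) : (Fin 3 → ℝ) →ₗ[ℝ] ℝ where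
  toFun v := det3 a b v
  map_add' v w := by simp only [det3_eq, Pi.add_apply]; ring
  map_smul' c v := by
    simp only [det3_eq, Pi.smul_apply, smul_eq_mul, RingHom.id_apply]; ring

@[simp] theorem detForm_apply (a b v : Fin 3 → ℝ) : detForm a b v = det3 a b v := rfl

theorem det3_rotate (a b c : Fin 3 → ℝ) : det3 b c a = det3 a b c := by
  simp only [det3_eq]; ring

theorem det3_swap_left (a b c : Fin 3 → ℝ) : det3 b a c = -det3 a b c := by
  simp only [det3_eq]; ring

theorem det3_swap_right (a b c : Fin 3 → ℝ) : det3 a c b = -det3 a b c := by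
  simp only [det3_eq]; ring

@[simp] theorem det3_self_right (a b : Fin 3 → ℝ) : det3 a b b = 0 := by
  simp only [det3_eq]; ring

@[simp] theorem det3_self_outer (a b : Fin 3 → ℝ) : det3 a b a = 0 := by
  simp only [det3_eq]; ring

theorem det3_add_smul (a b p q : Fin 3 → ℝ) (x y : ℝ) :
    det3 a b (x • p + y • q) = x * det3 a b p + y * det3 a b q := by
  simp only [det3_eq, Pi.add_apply, Pi.smul_apply, smul_eq_mul]; ring

/-- Cramer's rule. -/
theorem det3_smul_eq (a b c v : Fin 3 → ℝ) : det3 a b c • v =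
    det3 b c v • a + det3 a v c • b + det3 a b v • c := by
  ext k
  fin_cases k <;> simp [det3_eq] <;> ring

/-- Each coefficient is a ratio of one linear form at `v` and at the matching basis vector, the
shape to which `det3_div_det3` applies. -/
theorem cramer {a b c : Fin 3 → ℝ} (h : det3 a b c ≠ 0) (v : Fin 3 → ℝ) : v =
    (det3 v b c / det3 a b c) • a + (det3 v c a / det3 b c a) • b
      + (det3 v a b / det3 c a b) • c := by
  rw [det3_rotate a b c, ← det3_rotate c a b, ← smul_right_inj h, det3_smul_eq a b c v]
  simp only [smul_add, smul_smul, mul_div_cancel₀ _ h]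
  rw [det3_rotate v b c, ← det3_rotate a v c, det3_rotate v a b]

theorem det3_of_mem_span (v p q : Fin 3 → ℝ) (x y x' y' : ℝ) :
    det3 v (x • p + y • q) (x' • p + y' • q) = (x * y' - y * x') * det3 v p q := by
  simp only [det3_eq, Pi.add_apply, Pi.smul_apply, smul_eq_mul]; ring

/-- Two points of the line `p q` define the same functional up to scale. -/
theorem det3_div_det3 {b b' p q v w : Fin 3 → ℝ} (hb : ∃ x y : ℝ, b = x • p + y • q)
    (hb' : ∃ x y : ℝ, b' = x • p + y • q) (h : det3 w b b' ≠ 0) :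
    det3 v b b' / det3 w b b' = det3 v p q / det3 w p q := by
  obtain ⟨x, y, rfl⟩ := hb
  obtain ⟨x', y', rfl⟩ := hb'
  rw [det3_of_mem_span] at h
  rw [det3_of_mem_span, det3_of_mem_span, mul_div_mul_left _ _ (left_ne_zero_of_mul h)]

theorem det3_ne_zero_of_line {b b' p q v w : Fin 3 → ℝ} (hb : ∃ x y : ℝ, b = x • p + y • q)
    (hb' : ∃ x y : ℝ, b' = x • p + y • q) (h : det3 w b b' ≠ 0) (hv : det3 v p q ≠ 0) :
    det3 v b b' ≠ 0 := by
  obtain ⟨x, y, rfl⟩ := hb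
  obtain ⟨x', y', rfl⟩ := hb'
  rw [det3_of_mem_span] at h ⊢
  exact mul_ne_zero (left_ne_zero_of_mul h) hv

end Det

@[simp] theorem lift_two (p : ℝ × ℝ) : lift p 2 = 1 := rfl

theorem lift_lineMap (p q : ℝ × ℝ) (t : ℝ) :
    lift (AffineMap.lineMap p q t) = (1 - t) • lift p + t • lift q := by
  ext k
  fin_cases k <;> simp [lift, AffineMap.lineMap_apply] <;> ring

theorem small_ne_zero {n : ℕ} (hn : 5 ≤ n) :
    (1 : ZMod n) ≠ 0 ∧ (2 : ZMod n) ≠ 0 ∧ (3 : ZMod n) ≠ 0 ∧ (4 : ZMod n) ≠ 0 := by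
  have key : ∀ k : ℕ, 0 < k → k < 5 → ((k : ℕ) : ZMod n) ≠ 0 := by
    intro k h0 h5 h
    rw [ZMod.natCast_eq_zero_iff] at h
    have := Nat.le_of_dvd h0 h
    omega
  refine ⟨?_, ?_, ?_, ?_⟩
  · exact_mod_cast key 1 (by norm_num) (by norm_num)
  · exact_mod_cast key 2 (by norm_num) (by norm_num)
  · exact_mod_cast key 3 (by norm_num) (by norm_num)
  · exact_mod_cast key 4 (by norm_num) (by norm_num)

/-- Strict convexity with counterclockwise order of the vertices. -/
def IsPositive {n : ℕ} (A : ZMod n → ℝ × ℝ) : Prop :=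
  ∀ i j : ZMod n, j ≠ i → j ≠ i + 1 → 0 < det3 (lift (A i)) (lift (A (i + 1))) (lift (A j))

/-! ### Convex polygons and their image under the pentagram map. -/

section Positive

variable {n : ℕ} {A : ZMod n → ℝ × ℝ}

theorem IsPositive.edge_nonneg (hA : IsPositive A) (i j : ZMod n) :
    0 ≤ det3 (lift (A i)) (lift (A (i + 1))) (lift (A j)) := by
  by_cases h : j = i
  · simp [h]
  by_cases h' : j = i + 1
  · simp [h']
  exact (hA i j h h').le

theorem IsPositive.edge_nonneg' (hA : IsPositive A) (i j : ZMod n) :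
    0 ≤ det3 (lift (A (i - 1))) (lift (A i)) (lift (A j)) := by
  simpa using hA.edge_nonneg (i - 1) j

theorem IsPositive.ear_pos (hA : IsPositive A) (hn : 5 ≤ n) (i : ZMod n) :
    0 < det3 (lift (A (i - 1))) (lift (A i)) (lift (A (i + 1))) := by
  obtain ⟨h1, h2, -, -⟩ := small_ne_zero hn
  have := hA (i - 1) (i + 1) (fun h => h2 (by linear_combination h))
    (fun h => h1 (by linear_combination h))
  simpa using this

theorem IsPositive.ear_pos' (hA : IsPositive A) (hn : 5 ≤ n) (i : ZMod n) :
    0 < det3 (lift (A i)) (lift (A (i + 1))) (lift (A (i + 2))) := by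
  obtain ⟨h1, h2, -, -⟩ := small_ne_zero hn
  exact hA i (i + 2) (fun h => h2 (by linear_combination h))
    (fun h => h1 (by linear_combination h))

/-- A short diagonal separates the vertex it cuts off from all others. -/
theorem IsPositive.diag_pos (hA : IsPositive A) (hn : 5 ≤ n) (i m : ZMod n) (h0 : m ≠ i)
    (h1 : m ≠ i + 1) (h2 : m ≠ i + 2) :
    0 < det3 (lift (A i)) (lift (A (i + 2))) (lift (A m)) := by
  obtain ⟨-, k2, -, -⟩ := small_ne_zero hn
  by_contra! hneg
  -- Expand the lift of `A m` in the triangle at `i + 1` and apply the form of side `m`. The left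
  -- side vanishes; if the claim fails, the right side has three nonnegative terms, one of them
  -- positive.
  have hc := congrArg (detForm (lift (A m)) (lift (A (m + 1))))
    (det3_smul_eq (lift (A i)) (lift (A (i + 1))) (lift (A (i + 2))) (lift (A m)))
  simp only [map_add, map_smul, detForm_apply, smul_eq_mul, det3_self_outer, mul_zero] at hc
  rw [det3_swap_right (lift (A i)) (lift (A (i + 2))) (lift (A m))] at hc
  have e : i + 1 + 1 = i + 2 := by ring
  have f1 := hA (i + 1) m h1 (by rwa [e])
  rw [e] at f1
  have f0 := hA i m h0 h1
  have g0 := hA.edge_nonneg m i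
  have g1 := hA.edge_nonneg m (i + 1)
  have g2 := hA.edge_nonneg m (i + 2)
  have p0 := mul_nonneg f1.le g0
  have p1 := mul_nonneg (neg_nonneg.mpr hneg) g1
  have p2 := mul_nonneg f0.le g2
  by_cases hi : i = m + 1
  · have := mul_pos f0 (hA m (i + 2) (Ne.symm h2) (fun h => k2 (by linear_combination h - hi)))
    linarith
  · have := mul_pos f1 (hA m i (Ne.symm h0) hi)
    linarith

theorem IsPositive.diag_pos' (hA : IsPositive A) (hn : 5 ≤ n) (i m : ZMod n) (h0 : m ≠ i - 1)
    (h1 : m ≠ i) (h2 : m ≠ i + 1) :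
    0 < det3 (lift (A (i - 1))) (lift (A (i + 1))) (lift (A m)) := by
  have e : i - 1 + 2 = i + 1 := by ring
  have := hA.diag_pos hn (i - 1) m h0 (by simpa using h1) (by rwa [e])
  rwa [e] at this

theorem IsPositive.skip_pos (hA : IsPositive A) (hn : 5 ≤ n) (i : ZMod n) :
    0 < det3 (lift (A (i - 1))) (lift (A i)) (lift (A (i + 2))) := by
  obtain ⟨-, h2, h3, -⟩ := small_ne_zero hn
  simpa using hA (i - 1) (i + 2) (fun h => h3 (by linear_combination h))
    (fun h => h2 (by linear_combination h))

theorem IsPositive.skip_pos' (hA : IsPositive A) (hn : 5 ≤ n) (i : ZMod n) :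
    0 < det3 (lift (A (i - 1))) (lift (A (i + 1))) (lift (A (i + 2))) := by
  obtain ⟨h1, h2, h3, -⟩ := small_ne_zero hn
  exact hA.diag_pos' hn i (i + 2) (fun h => h3 (by linear_combination h))
    (fun h => h2 (by linear_combination h)) (fun h => h1 (by linear_combination h))

/-- The weights are, up to sign, the heights of `A (i + 1)` and `A (i - 1)` over the diagonal `A i A
(i + 2)`, which lies between them. Clearing the denominator keeps them available for estimates. -/
theorem IsPositive.smul_lift_pentagramMap (hA : IsPositive A) (hn : 5 ≤ n) (i : ZMod n) :
    (det3 (lift (A i)) (lift (A (i + 1))) (lift (A (i + 2)))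
      + det3 (lift (A (i - 1))) (lift (A i)) (lift (A (i + 2)))) • lift (pentagramMap A i) =
    det3 (lift (A i)) (lift (A (i + 1))) (lift (A (i + 2))) • lift (A (i - 1))
      + det3 (lift (A (i - 1))) (lift (A i)) (lift (A (i + 2))) • lift (A (i + 1)) := by
  have hp := hA.ear_pos' hn i
  have hq := hA.skip_pos hn i
  set p := det3 (lift (A i)) (lift (A (i + 1))) (lift (A (i + 2))) with hpd
  set q := det3 (lift (A (i - 1))) (lift (A i)) (lift (A (i + 2))) with hqd
  have e1 : orient (A i) (A (i + 2)) (A (i - 1)) = q := by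
    rw [orient, hqd, det3_rotate (lift (A (i - 1)))]
  have e2 : orient (A i) (A (i + 2)) (A (i + 1)) = -p := by
    rw [orient, hpd, det3_swap_right]
  rw [pentagramMap, lineInter, lift_lineMap, e1, e2, smul_add, smul_smul, smul_smul]
  have : p + q ≠ 0 := by positivity
  have : q - -p ≠ 0 := by rw [sub_neg_eq_add]; positivity
  congr 2 <;> field_simp <;> ring

theorem IsPositive.lift_pentagramMap (hA : IsPositive A) (hn : 5 ≤ n) (i : ZMod n) :
    ∃ p q : ℝ, 0 < p ∧ 0 < q ∧ p + q = 1 ∧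
      lift (pentagramMap A i) = p • lift (A (i - 1)) + q • lift (A (i + 1)) := by
  have hp := hA.ear_pos' hn i
  have hq := hA.skip_pos hn i
  have h := hA.smul_lift_pentagramMap hn i
  set p := det3 (lift (A i)) (lift (A (i + 1))) (lift (A (i + 2)))
  set q := det3 (lift (A (i - 1))) (lift (A i)) (lift (A (i + 2)))
  have hpq : p + q ≠ 0 := by positivity
  refine ⟨p / (p + q), q / (p + q), by positivity, by positivity, by field_simp, ?_⟩
  rw [← smul_right_inj hpq, h, smul_add, smul_smul, smul_smul, mul_div_cancel₀ _ hpq,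
    mul_div_cancel₀ _ hpq]

theorem IsPositive.lift_pentagramMap' (hA : IsPositive A) (hn : 5 ≤ n) (i : ZMod n) :
    ∃ p q : ℝ, 0 < p ∧ 0 < q ∧ p + q = 1 ∧
      lift (pentagramMap A i) = p • lift (A i) + q • lift (A (i + 2)) := by
  have hp := hA.ear_pos' hn i
  have hq := hA.skip_pos hn i
  have hr := hA.skip_pos' hn i
  have hm := hA.ear_pos hn i
  have h := hA.smul_lift_pentagramMap hn i
  -- The linear relation among four consecutive lifts puts the same point on the other diagonal; its
  -- last coordinate says that the total weights agree.
  have hid : det3 (lift (A i)) (lift (A (i + 1))) (lift (A (i + 2))) • lift (A (i - 1))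
      + det3 (lift (A (i - 1))) (lift (A i)) (lift (A (i + 2))) • lift (A (i + 1)) =
      det3 (lift (A (i - 1))) (lift (A (i + 1))) (lift (A (i + 2))) • lift (A i) +
      det3 (lift (A (i - 1))) (lift (A i)) (lift (A (i + 1))) • lift (A (i + 2)) := by
    have := det3_smul_eq (lift (A (i - 1))) (lift (A i)) (lift (A (i + 1))) (lift (A (i + 2)))
    rw [this, det3_swap_right (lift (A (i - 1))) (lift (A (i + 1)))]
    module
  have hs := congrFun hid 2
  simp at hs
  set p := det3 (lift (A i)) (lift (A (i + 1))) (lift (A (i + 2)))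
  set q := det3 (lift (A (i - 1))) (lift (A i)) (lift (A (i + 2)))
  set r := det3 (lift (A (i - 1))) (lift (A (i + 1))) (lift (A (i + 2)))
  set m := det3 (lift (A (i - 1))) (lift (A i)) (lift (A (i + 1)))
  have hrm : r + m ≠ 0 := by positivity
  refine ⟨r / (r + m), m / (r + m), by positivity, by positivity, by field_simp, ?_⟩
  rw [← smul_right_inj hrm, ← hs, h, hid, hs, smul_add, smul_smul, smul_smul,
    mul_div_cancel₀ _ hrm, mul_div_cancel₀ _ hrm]

/-- The pentagram map preserves strict convexity. -/
theorem IsPositive.pentagram (hA : IsPositive A) (hn : 5 ≤ n) :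
    IsPositive (pentagramMap A) := by
  obtain ⟨k1, k2, k3, k4⟩ := small_ne_zero hn
  intro i j hji hji'
  obtain ⟨r, m, hr, hm, -, hB⟩ := hA.lift_pentagramMap' hn i
  obtain ⟨p, q, hp, hq, -, hB'⟩ := hA.lift_pentagramMap hn (i + 1)
  obtain ⟨a, b, ha, hb, -, hC⟩ := hA.lift_pentagramMap' hn (i + 1)
  obtain ⟨c, d, hc, hd, -, hD⟩ := hA.lift_pentagramMap hn i
  have e1 : i + 1 - 1 = i := by ring
  have e2 : i + 1 + 1 = i + 2 := by ring
  have e3 : i + 1 + 2 = i + 3 := by ring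
  rw [e1, e2] at hB'
  rw [e3] at hC
  -- Vertices `i` and `i + 1` of the image both lie on the diagonal `A i A (i + 2)`; this says that
  -- they follow each other in its direction. The form of the diagonal `A (i - 1) A (i + 1)`
  -- vanishes at the first and is positive at the second.
  have hκ : 0 < r * q - m * p := by
    have z0 : det3 (lift (A (i - 1))) (lift (A (i + 1))) (lift (pentagramMap A i)) = 0 := by
      rw [hD, det3_add_smul]; simp
    have z1 : 0 < det3 (lift (A (i - 1))) (lift (A (i + 1)))
        (lift (pentagramMap A (i + 1))) := by
      rw [hC, det3_add_smul, det3_self_right, mul_zero, zero_add]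
      exact mul_pos hb (hA.diag_pos' hn i (i + 3) (fun h => k4 (by linear_combination h))
        (fun h => k3 (by linear_combination h)) (fun h => k2 (by linear_combination h)))
    rw [hB, det3_add_smul] at z0
    rw [hB', det3_add_smul] at z1
    have z2 := hA.skip_pos' hn i
    have z3 := mul_pos hr z1
    have : 0 < (r * q - m * p) *
        det3 (lift (A (i - 1))) (lift (A (i + 1))) (lift (A (i + 2))) := by
      linear_combination z3 + p * z0
    exact pos_of_mul_pos_left this z2.le
  have hside : ∀ k, k ≠ i + 1 → 0 ≤ det3 (lift (A i)) (lift (A (i + 2))) (lift (A k)) := by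
    intro k hk
    by_cases h0 : k = i
    · simp [h0]
    by_cases h2 : k = i + 2
    · simp [h2]
    exact (hA.diag_pos hn i k h0 hk h2).le
  -- Only `A (i + 1)` lies on the wrong side of this diagonal. The representation by `A (j - 1)`, `A
  -- (j + 1)` avoids it unless `j = i + 2`, where the other diagonal is used.
  have hmain : 0 < det3 (lift (A i)) (lift (A (i + 2))) (lift (pentagramMap A j)) := by
    by_cases hj2 : j = i + 2
    · obtain ⟨s, t, hs, ht, -, hE⟩ := hA.lift_pentagramMap' hn j
      rw [hE, det3_add_smul, hj2, det3_self_right, mul_zero, zero_add]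
      exact mul_pos ht (hA.diag_pos hn i (i + 2 + 2) (fun h => k4 (by linear_combination h))
        (fun h => k3 (by linear_combination h)) (fun h => k2 (by linear_combination h)))
    · obtain ⟨s, t, hs, ht, -, hE⟩ := hA.lift_pentagramMap hn j
      rw [hE, det3_add_smul]
      have h1 : j - 1 ≠ i + 1 := fun h => hj2 (by linear_combination h)
      have h2 : j + 1 ≠ i + 1 := fun h => hji (by linear_combination h)
      have n1 := mul_nonneg hs.le (hside _ h1)
      have n2 := mul_nonneg ht.le (hside _ h2)
      by_cases h3 : j - 1 = i + 2
      · have := mul_pos ht (hA.diag_pos hn i (j + 1) (fun h => k4 (by linear_combination h - h3))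
          h2 (fun h => k2 (by linear_combination h - h3)))
        linarith
      · have := mul_pos hs (hA.diag_pos hn i (j - 1) (fun h => hji' (by linear_combination h))
          h1 h3)
        linarith
  rw [hB, hB', det3_rotate (lift (pentagramMap A j)), det3_of_mem_span,
    ← det3_rotate (lift (pentagramMap A j))]
  exact mul_pos hκ hmain

theorem IsPositive.iterate (hA : IsPositive A) (hn : 5 ≤ n) (k : ℕ) :
    IsPositive (pentagramMap^[k] A) := by
  induction k with
  | zero => exact hA
  | succ k ih => rw [Function.iterate_succ_apply']; exact ih.pentagram hn

/-- Half-planes that contain the polygon contain its image under the pentagram map. -/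
theorem IsPositive.le_form_pentagramMap (hA : IsPositive A) (hn : 5 ≤ n)
    (l : (Fin 3 → ℝ) →ₗ[ℝ] ℝ) {c : ℝ} (hc : ∀ i, c ≤ l (lift (A i))) (i : ZMod n) :
    c ≤ l (lift (pentagramMap A i)) := by
  obtain ⟨p, q, hp, hq, hpq, h⟩ := hA.lift_pentagramMap hn i
  rw [h, map_add, map_smul, map_smul, smul_eq_mul, smul_eq_mul]
  have h1 := mul_le_mul_of_nonneg_left (hc (i - 1)) hp.le
  have h2 := mul_le_mul_of_nonneg_left (hc (i + 1)) hq.le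
  have : c = p * c + q * c := by rw [← add_mul, hpq, one_mul]
  linarith

theorem IsPositive.le_form_iterate (hA : IsPositive A) (hn : 5 ≤ n)
    (l : (Fin 3 → ℝ) →ₗ[ℝ] ℝ) {c : ℝ} (hc : ∀ i, c ≤ l (lift (A i))) (k : ℕ) (i : ZMod n) :
    c ≤ l (lift (pentagramMap^[k] A i)) := by
  induction k generalizing i with
  | zero => exact hc i
  | succ k ih =>
    rw [Function.iterate_succ_apply']
    exact (hA.iterate hn k).le_form_pentagramMap hn l ih i

theorem IsPositive.form_iterate_le (hA : IsPositive A) (hn : 5 ≤ n)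
    (l : (Fin 3 → ℝ) →ₗ[ℝ] ℝ) {c : ℝ} (hc : ∀ i, l (lift (A i)) ≤ c) (k : ℕ) (i : ZMod n) :
    l (lift (pentagramMap^[k] A i)) ≤ c := by
  have := hA.le_form_iterate hn (-l) (c := -c) (fun i => by simpa using hc i) k i
  simpa using this

end Positive

/-! ### Invariance of Glick's operator. -/

section Invariance

variable {n : ℕ} [NeZero n] {A : ZMod n → ℝ × ℝ}

theorem glickMap_apply (A : ZMod n → ℝ × ℝ) (v : Fin 3 → ℝ) :
    glickMap A v = (n : ℝ) • v - ∑ j : ZMod n,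
      (det3 (lift (A (j - 1))) v (lift (A (j + 1))) /
        det3 (lift (A (j - 1))) (lift (A j)) (lift (A (j + 1)))) • lift (A j) := rfl

theorem glickMap_eq_sum (A : ZMod n → ℝ × ℝ) (v : Fin 3 → ℝ) :
    glickMap A v = ∑ j : ZMod n,
      (v - (det3 (lift (A (j - 1))) v (lift (A (j + 1))) /
        det3 (lift (A (j - 1))) (lift (A j)) (lift (A (j + 1)))) • lift (A j)) := by
  rw [glickMap_apply, Finset.sum_sub_distrib, Finset.sum_const, Finset.card_univ, ZMod.card,
    Nat.cast_smul_eq_nsmul]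

/-- Glick's operator is invariant under the pentagram map. -/
theorem IsPositive.glickMap_pentagramMap (hA : IsPositive A) (hn : 5 ≤ n) :
    glickMap (pentagramMap A) = glickMap A := by
  have hB := hA.pentagram hn
  apply LinearMap.ext
  intro v
  set u : ZMod n → Fin 3 → ℝ := fun i => lift (A i)
  set b : ZMod n → Fin 3 → ℝ := fun i => lift (pentagramMap A i)
  have hspan : ∀ i, ∃ x y : ℝ, b i = x • u (i - 1) + y • u (i + 1) := fun i =>
    let ⟨x, y, _, _, _, h⟩ := hA.lift_pentagramMap hn i
    ⟨x, y, h⟩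
  have hspan' : ∀ i, ∃ x y : ℝ, b i = x • u i + y • u (i + 2) := fun i =>
    let ⟨x, y, _, _, _, h⟩ := hA.lift_pentagramMap' hn i
    ⟨x, y, h⟩
  have hear : ∀ i, det3 (b (i - 1)) (b i) (b (i + 1)) ≠ 0 := fun i => (hB.ear_pos hn i).ne'
  -- `χ i` vanishes on the diagonal `A (i - 1) A (i + 1)`, which carries `b (i - 1)` and `b i`. All
  -- Cramer coefficients below become ratios of values of these forms.
  set χ : ZMod n → (Fin 3 → ℝ) → ℝ := fun i w => det3 w (u (i - 1)) (u (i + 1)) with hχ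
  have ratio : ∀ i w c d, (∃ x y : ℝ, c = x • u (i - 1) + y • u (i + 1)) →
      (∃ x y : ℝ, d = x • u (i - 1) + y • u (i + 1)) → det3 w c d ≠ 0 →
      det3 v c d / det3 w c d = χ i v / χ i w :=
    fun i w c d hc hd h => det3_div_det3 hc hd h
  have hpred : ∀ i, ∃ x y : ℝ, b (i - 1) = x • u (i - 1) + y • u (i + 1) := by
    intro i
    have h := hspan' (i - 1)
    rwa [show i - 1 + 2 = i + 1 by ring] at h
  have hsame : ∀ i, ∃ x y : ℝ, u (i + 1) = x • u (i - 1) + y • u (i + 1) :=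
    fun i => ⟨0, 1, by simp⟩
  have hsame' : ∀ i, ∃ x y : ℝ, u (i - 1) = x • u (i - 1) + y • u (i + 1) :=
    fun i => ⟨1, 0, by simp⟩
  have first : ∀ i, v - (det3 (b (i - 1)) v (b (i + 1)) / det3 (b (i - 1)) (b i) (b (i + 1))) • b i
      = (χ (i + 1) v / χ (i + 1) (b (i - 1))) • b (i - 1)
        + (χ i v / χ i (b (i + 1))) • b (i + 1) := by
    intro i
    have h := hear i
    have hc := cramer h v
    rw [ratio (i + 1) _ _ _ (by simpa using hpred (i + 1)) (hspan (i + 1)) h,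
      ratio i _ _ _ (hpred i) (hspan i) (by rwa [← det3_rotate, ← det3_rotate] at h),
      det3_rotate (b (i - 1)) v, det3_rotate (b (i - 1)) (b i)] at hc
    rw [sub_eq_iff_eq_add]
    exact hc.trans (add_right_comm _ _ _)
  -- Cramer in the mixed basis `b i`, `u (i + 1)`, `b (i + 1)`: each pair spans a short diagonal,
  -- and the coefficient of `u (i + 1)` is exactly the one in the operator of `A`.
  have second : ∀ i, v - (det3 (u i) v (u (i + 2)) / det3 (u i) (u (i + 1)) (u (i + 2))) • u (i + 1)
      = (χ (i + 2) v / χ (i + 2) (b i)) • b i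
        + (χ i v / χ i (b (i + 1))) • b (i + 1) := by
    intro i
    have e1 : i + 1 - 1 = i := by ring
    have e2 : i + 1 + 1 = i + 2 := by ring
    have e3 : i + 2 - 1 = i + 1 := by ring
    have hb0 := hpred (i + 1)
    have hb1 := hspan (i + 1)
    have hu1 := hsame' (i + 2)
    have hb2 := hpred (i + 2)
    rw [e1] at hb0 hb1
    rw [e3] at hu1 hb2
    have h : det3 (u (i + 1)) (b i) (b (i + 1)) ≠ 0 := by
      refine det3_ne_zero_of_line (hspan' i) (by rwa [e2] at hb1) (hear i) ?_
      rw [det3_swap_left]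
      exact neg_ne_zero.mpr (hA.ear_pos' hn i).ne'
    have h' : det3 (b (i + 1)) (u (i + 1)) (b i) ≠ 0 := by rw [← det3_rotate]; exact h
    have hc := cramer h' v
    rw [ratio i _ _ _ (hsame i) (hspan i) h',
      ratio (i + 1) _ _ _ (by rwa [e1]) (by rwa [e1]) h,
      ratio (i + 2) (b i) (b (i + 1)) (u (i + 1)) (by rwa [e3]) (by rwa [e3])
        (by rw [← det3_rotate]; exact h')] at hc
    have hm : χ (i + 1) v / χ (i + 1) (u (i + 1)) =
        det3 (u i) v (u (i + 2)) / det3 (u i) (u (i + 1)) (u (i + 2)) := by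
      simp only [hχ]
      rw [e1, e2, det3_swap_left (u i), det3_swap_left (u i), neg_div_neg_eq]
    rw [hm] at hc
    rw [sub_eq_iff_eq_add]
    exact hc.trans (by abel)
  rw [glickMap_eq_sum, glickMap_eq_sum]
  calc _ = ∑ i, ((χ (i + 1) v / χ (i + 1) (b (i - 1))) • b (i - 1)
        + (χ i v / χ i (b (i + 1))) • b (i + 1)) := Finset.sum_congr rfl fun i _ => first i
    _ = ∑ i, ((χ (i + 2) v / χ (i + 2) (b i)) • b i + (χ i v / χ i (b (i + 1))) • b (i + 1)) := by
      -- The two sums differ only by a shift of the index in their first halves.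
      rw [Finset.sum_add_distrib, Finset.sum_add_distrib]
      congr 1
      refine (Fintype.sum_equiv (Equiv.addRight (1 : ZMod n)) _ _ fun i => ?_).symm
      simp only [Equiv.coe_addRight, add_sub_cancel_right]
      rw [show i + 1 + 1 = i + 2 by ring]
    _ = _ := by
      refine Fintype.sum_equiv (Equiv.addRight (1 : ZMod n)) _ _ fun i => ?_
      rw [← second i]
      simp only [Equiv.coe_addRight, add_sub_cancel_right]
      rw [show i + 1 + 1 = i + 2 by ring]

theorem IsPositive.glickMap_iterate (hA : IsPositive A) (hn : 5 ≤ n) (k : ℕ) :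
    glickMap (pentagramMap^[k] A) = glickMap A := by
  induction k with
  | zero => rfl
  | succ k ih =>
    rw [Function.iterate_succ_apply', (hA.iterate hn k).glickMap_pentagramMap hn, ih]

end Invariance


/-! ### Uniform shape bounds and convergence. -/

section Contraction

variable {n : ℕ} [NeZero n] {A : ZMod n → ℝ × ℝ}

/-- Glick's operator as a sum with coefficients that are nonnegative on the cone over the
polygon. -/
theorem IsPositive.glickMap_eq (hA : IsPositive A) (hn : 5 ≤ n) (v : Fin 3 → ℝ) :
    glickMap A v = ∑ j : ZMod n,
      ((det3 (lift (A j)) (lift (A (j + 1))) v /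
          det3 (lift (A (j - 1))) (lift (A j)) (lift (A (j + 1)))) • lift (A (j - 1)) +
        (det3 (lift (A (j - 1))) (lift (A j)) v /
          det3 (lift (A (j - 1))) (lift (A j)) (lift (A (j + 1)))) • lift (A (j + 1))) := by
  rw [glickMap_eq_sum]
  refine Finset.sum_congr rfl fun j _ => ?_
  have h := (hA.ear_pos hn j).ne'
  rw [← smul_right_inj h, smul_sub, smul_add, smul_smul, smul_smul, smul_smul,
    mul_div_cancel₀ _ h, mul_div_cancel₀ _ h, mul_div_cancel₀ _ h,
    det3_smul_eq _ _ _ v]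
  abel

/-- A point on the inner side of every edge satisfies every linear inequality that holds at the
vertices. -/
theorem IsPositive.form_le_of_edge_nonneg (hA : IsPositive A) (hn : 5 ≤ n)
    (l : (Fin 3 → ℝ) →ₗ[ℝ] ℝ) {c : ℝ} (hc : ∀ i, l (lift (A i)) ≤ c) {z : Fin 3 → ℝ}
    (hz : ∀ i, 0 ≤ det3 (lift (A i)) (lift (A (i + 1))) z) (h2 : z 2 = 1) : l z ≤ c := by
  obtain ⟨i, hi⟩ := Finite.exists_max fun i => l (lift (A i))
  refine le_trans ?_ (hc i)
  have ht := hA.ear_pos hn i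
  -- At a maximizing vertex only the neighbours' coefficients need a sign: the last coordinate fixes
  -- the sum, so the coefficient of `A i` itself may be negative.
  have hcr := det3_smul_eq (lift (A (i - 1))) (lift (A i)) (lift (A (i + 1))) z
  have h1 := congrArg l hcr
  have h3 := congrFun hcr 2
  simp only [map_add, map_smul, smul_eq_mul] at h1
  simp [h2] at h3
  have m1 := mul_le_mul_of_nonneg_left (hi (i - 1)) (hz i)
  have m2 := mul_le_mul_of_nonneg_left (hi (i + 1)) (by simpa using hz (i - 1) :
    0 ≤ det3 (lift (A (i - 1))) (lift (A i)) z)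
  rw [← mul_le_mul_iff_right₀ ht, h1, h3]
  linarith

/-- The heights of the vertices over an edge are at least the smaller one of the two heights next
to the edge. -/
theorem IsPositive.le_edge (hA : IsPositive A) (hn : 5 ≤ n) {τ : ℝ}
    (hτ : ∀ j, τ ≤ det3 (lift (A (j - 1))) (lift (A j)) (lift (A (j + 1))))
    {i j : ZMod n} (hj : j ≠ i) (hj' : j ≠ i + 1) :
    τ ≤ det3 (lift (A i)) (lift (A (i + 1))) (lift (A j)) := by
  classical
  have hne : (Finset.univ.filter fun j : ZMod n => j ≠ i ∧ j ≠ i + 1).Nonempty :=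
    ⟨j, by simp [hj, hj']⟩
  obtain ⟨m, hm, hmin⟩ := Finset.exists_min_image _
    (fun j => det3 (lift (A i)) (lift (A (i + 1))) (lift (A j))) hne
  simp only [Finset.mem_filter, Finset.mem_univ, true_and, and_imp] at hm hmin
  refine le_trans ?_ (hmin j hj hj')
  by_cases h1 : m - 1 = i + 1
  · have := hτ (i + 1)
    rw [show i + 1 - 1 = i by ring] at this
    rwa [show m = i + 1 + 1 by linear_combination h1]
  by_cases h2 : m + 1 = i
  · have := hτ i
    rw [← det3_rotate] at this
    rwa [show m = i - 1 by linear_combination h2]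
  exfalso
  have n1 : m - 1 ≠ i := fun h => hm.2 (by linear_combination h)
  have n2 : m + 1 ≠ i + 1 := fun h => hm.1 (by linear_combination h)
  -- A lowest vertex `m` not next to the edge is impossible: `A i` has height 0, but expanding it in
  -- the ear at `m` makes its height at least the positive height of `A m`.
  have hcr := det3_smul_eq (lift (A (m - 1))) (lift (A m)) (lift (A (m + 1))) (lift (A i))
  have e1 := congrArg (detForm (lift (A i)) (lift (A (i + 1)))) hcr
  have e3 := congrFun hcr 2
  simp only [map_add, map_smul, smul_eq_mul, detForm_apply, det3_self_outer, mul_zero] at e1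
  simp at e3
  have m1 := mul_le_mul_of_nonneg_left (hmin (m - 1) n1 h1) (hA.edge_nonneg m i)
  have m2 := mul_le_mul_of_nonneg_left (hmin (m + 1) h2 n2) (hA.edge_nonneg' m i)
  have hp := mul_pos (hA.ear_pos hn m) (hA i m hm.1 hm.2)
  rw [e3] at hp
  linarith

/-- If every height over an edge is at most `M` times the areas of the triangles cut off at both
ends of this edge, then the distances of the vertices of the next polygon to the sides are
comparable. -/
theorem IsPositive.edge_pentagramMap_le (hA : IsPositive A) (hn : 5 ≤ n) {M : ℝ} (hM : 1 ≤ M)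
    (hMA : ∀ i j, det3 (lift (A j)) (lift (A (j + 1))) (lift (A i)) ≤
      M * det3 (lift (A (j - 1))) (lift (A j)) (lift (A (j + 1)))) (j a b : ZMod n) :
    det3 (lift (A j)) (lift (A (j + 1))) (lift (pentagramMap A b)) ≤
      M ^ (2 * n + 1) * (1 + M ^ (2 * n + 1)) *
        det3 (lift (A j)) (lift (A (j + 1))) (lift (pentagramMap A a)) := by
  obtain ⟨k1, k2, k3, k4⟩ := small_ne_zero hn
  set t : ZMod n → ℝ := fun j => det3 (lift (A (j - 1))) (lift (A j)) (lift (A (j + 1))) with ht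
  have htpos : ∀ j, 0 < t j := fun j => hA.ear_pos hn j
  -- The ear area at `j + 1` is also the height of `A (j + 2)` over side `j`. Going around the cycle
  -- makes all ear areas comparable.
  have hstep : ∀ j, t (j + 1) ≤ M * t j := by
    intro j
    have := hMA (j + 1 + 1) j
    simpa [ht] using this
  have hpow : ∀ m : ℕ, ∀ j, t (j + m) ≤ M ^ m * t j := by
    intro m
    induction m with
    | zero => simp
    | succ m ih =>
      intro j
      calc t (j + (m + 1 : ℕ)) = t (j + m + 1) := by push_cast; rw [add_assoc]
        _ ≤ M * t (j + m) := hstep _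
        _ ≤ M * (M ^ m * t j) := by gcongr; exact ih j
        _ = _ := by ring
  have hcomp : ∀ i j, t i ≤ M ^ n * t j := by
    intro i j
    have h := hpow (i - j).val j
    rw [ZMod.natCast_zmod_val, add_sub_cancel] at h
    refine h.trans (mul_le_mul_of_nonneg_right ?_ (htpos j).le)
    exact pow_le_pow_right₀ hM (ZMod.val_lt _).le
  -- `τ` bounds every ear, hence every nonzero edge height, from below; `Q * τ = M * (M ^ n * t 0)`
  -- bounds them from above.
  set τ := t 0 / M ^ n with hτ
  set Q := M ^ (2 * n + 1) with hQ
  have hMpos : 0 < M := by linarith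
  have hτpos : 0 < τ := div_pos (htpos 0) (by positivity)
  have hQpos : 0 < Q := by positivity
  have hτle : ∀ j, τ ≤ t j := fun j => by
    rw [hτ, div_le_iff₀ (by positivity), mul_comm]
    exact hcomp 0 j
  have hlow : ∀ i j, j ≠ i → j ≠ i + 1 → τ ≤ det3 (lift (A i)) (lift (A (i + 1))) (lift (A j)) :=
    fun i j h h' => hA.le_edge hn hτle h h'
  have hup : ∀ i j, det3 (lift (A i)) (lift (A (i + 1))) (lift (A j)) ≤ Q * τ := by
    intro i j
    calc _ ≤ M * t i := hMA j i
      _ ≤ M * (M ^ n * t 0) := by gcongr; exact hcomp i 0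
      _ = Q * τ := by rw [hQ, hτ]; field_simp; ring
  have hBup : det3 (lift (A j)) (lift (A (j + 1))) (lift (pentagramMap A b)) ≤ Q * τ := by
    have := hA.le_form_pentagramMap hn (-detForm (lift (A j)) (lift (A (j + 1)))) (c := -(Q * τ))
      (fun i => by simpa using hup j i) b
    simpa using this
  have hBlow : τ ≤ (1 + Q) * det3 (lift (A j)) (lift (A (j + 1))) (lift (pentagramMap A a)) := by
    have h := congrArg (detForm (lift (A j)) (lift (A (j + 1)))) (hA.smul_lift_pentagramMap hn a)
    simp only [map_add, map_smul, smul_eq_mul, detForm_apply] at h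
    have p1 : τ ≤ det3 (lift (A a)) (lift (A (a + 1))) (lift (A (a + 2))) :=
      hlow a (a + 2) (fun h => k2 (by linear_combination h)) (fun h => k1 (by linear_combination h))
    have p2 := hup a (a + 2)
    have q1 : τ ≤ det3 (lift (A (a - 1))) (lift (A a)) (lift (A (a + 2))) := by
      simpa using hlow (a - 1) (a + 2) (fun h => k3 (by linear_combination h))
        (fun h => k2 (by linear_combination h))
    have q2 : det3 (lift (A (a - 1))) (lift (A a)) (lift (A (a + 2))) ≤ Q * τ := by
      simpa using hup (a - 1) (a + 2)
    set p := det3 (lift (A a)) (lift (A (a + 1))) (lift (A (a + 2)))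
    set q := det3 (lift (A (a - 1))) (lift (A a)) (lift (A (a + 2)))
    set x := det3 (lift (A j)) (lift (A (j + 1))) (lift (pentagramMap A a))
    have y1 := hA.edge_nonneg j (a - 1)
    have y2 := hA.edge_nonneg j (a + 1)
    have hpq : (p + q) * τ ≤ (p + q) * ((1 + Q) * x) := by
      have e : (p + q) * ((1 + Q) * x) = (1 + Q) * ((p + q) * x) := by ring
      rw [e, h]
      have hpp : 0 < p := hτpos.trans_le p1
      have hqp : 0 < q := hτpos.trans_le q1
      -- At least one of `A (a - 1)`, `A (a + 1)` is off side `j`, so has height at least `τ`; its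
      -- normalized weight is at least `1 / (1 + Q)`, since `p` and `q` lie between `τ` and `Q * τ`.
      by_cases hc : a + 1 = j ∨ a + 1 = j + 1
      · have hy : τ ≤ det3 (lift (A j)) (lift (A (j + 1))) (lift (A (a - 1))) := by
          apply hlow
          · intro h'
            rcases hc with hc | hc
            · exact k2 (by linear_combination hc - h')
            · exact k1 (by linear_combination hc - h')
          · intro h'
            rcases hc with hc | hc
            · exact k3 (by linear_combination hc - h')
            · exact k2 (by linear_combination hc - h')
        have z1 : p + q ≤ (1 + Q) * p := by
          have := mul_le_mul_of_nonneg_left p1 hQpos.le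
          linarith
        have z2 := mul_le_mul z1 hy hτpos.le (by positivity)
        have z3 := mul_nonneg (by positivity : 0 ≤ (1 + Q)) (mul_nonneg hqp.le y2)
        linarith
      · have hy : τ ≤ det3 (lift (A j)) (lift (A (j + 1))) (lift (A (a + 1))) := by
          push Not at hc
          exact hlow _ _ hc.1 hc.2
        have z1 : p + q ≤ (1 + Q) * q := by
          have := mul_le_mul_of_nonneg_left q1 hQpos.le
          linarith
        have z2 := mul_le_mul z1 hy hτpos.le (by positivity)
        have z3 := mul_nonneg (by positivity : 0 ≤ (1 + Q)) (mul_nonneg hpp.le y1)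
        linarith
    exact le_of_mul_le_mul_left hpq (by linarith)
  calc _ ≤ Q * τ := hBup
    _ ≤ Q * ((1 + Q) * det3 (lift (A j)) (lift (A (j + 1))) (lift (pentagramMap A a))) := by gcongr
    _ = _ := by ring

/-- Comparable distances to the sides make the oscillation of every linear form shrink. -/
theorem IsPositive.oscillation_pentagramMap (hA : IsPositive A) (hn : 5 ≤ n) {R : ℝ} (hR : 0 < R)
    (hRA : ∀ j a b, det3 (lift (A j)) (lift (A (j + 1))) (lift (pentagramMap A b)) ≤
      R * det3 (lift (A j)) (lift (A (j + 1))) (lift (pentagramMap A a)))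
    (l : (Fin 3 → ℝ) →ₗ[ℝ] ℝ) {D : ℝ} (hD : ∀ a b, l (lift (A b)) - l (lift (A a)) ≤ D)
    (a b : ZMod n) :
    l (lift (pentagramMap A b)) - l (lift (pentagramMap A a)) ≤ R / (R + 1) * D := by
  obtain ⟨i, hi⟩ := Finite.exists_max fun i => l (lift (A i))
  obtain ⟨i', hi'⟩ := Finite.exists_min fun i => l (lift (A i))
  -- Prolonging the segment from `a` to `b` by the fraction `R⁻¹` of its length stays inside the old
  -- polygon, so `1 + R⁻¹` times the new oscillation is at most the old one.
  set z := lift (pentagramMap A b) + R⁻¹ • (lift (pentagramMap A b) - lift (pentagramMap A a))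
    with hz
  have h1 : l z ≤ l (lift (A i)) := by
    refine hA.form_le_of_edge_nonneg hn l hi (fun j => ?_) (by simp [hz])
    have h0 := hRA j b a
    rw [← detForm_apply, hz, map_add, map_smul, map_sub, smul_eq_mul]
    simp only [detForm_apply]
    have h4 := mul_le_mul_of_nonneg_left h0 (inv_pos.mpr hR).le
    rw [inv_mul_cancel_left₀ hR.ne'] at h4
    have h5 : 0 ≤ det3 (lift (A j)) (lift (A (j + 1))) (lift (pentagramMap A b)) :=
      hA.le_form_pentagramMap hn (detForm (lift (A j)) (lift (A (j + 1))))
        (fun i => hA.edge_nonneg j i) b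
    have h6 := mul_nonneg (inv_pos.mpr hR).le h5
    linarith
  have h2 := hA.le_form_pentagramMap hn l hi' a
  have h3 := hD i' i
  rw [hz, map_add, map_smul, map_sub, smul_eq_mul] at h1
  have h4 : (1 + R⁻¹) * (l (lift (pentagramMap A b)) - l (lift (pentagramMap A a))) ≤ D := by
    linarith
  have h5 : (1 + R⁻¹) = (R + 1) / R := by field_simp
  rw [h5] at h4
  rw [div_mul_eq_mul_div, le_div_iff₀ (by positivity)]
  rw [div_mul_eq_mul_div, div_le_iff₀ hR] at h4
  linarith

/-- The operator bounds the shape of all iterates. -/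
theorem IsPositive.exists_shape_bound (hA : IsPositive A) (hn : 5 ≤ n) :
    ∃ M : ℝ, 1 ≤ M ∧ ∀ (k : ℕ) (i j : ZMod n),
      det3 (lift (pentagramMap^[k] A j)) (lift (pentagramMap^[k] A (j + 1)))
          (lift (pentagramMap^[k] A i)) ≤
        M * det3 (lift (pentagramMap^[k] A (j - 1))) (lift (pentagramMap^[k] A j))
          (lift (pentagramMap^[k] A (j + 1))) := by
  -- On vertices of any iterate this form is a sum of nonnegative coefficients, so it dominates each
  -- of them.
  set l : (Fin 3 → ℝ) →ₗ[ℝ] ℝ := LinearMap.proj 2 ∘ₗ glickMap A with hl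
  obtain ⟨i₀, hi₀⟩ := Finite.exists_max fun i => l (lift (A i))
  refine ⟨max 1 (l (lift (A i₀))), le_max_left _ _, fun k i j => ?_⟩
  have hk := hA.iterate hn k
  have h1 := hA.form_iterate_le hn l hi₀ k i
  have h2 : l (lift (pentagramMap^[k] A i)) =
      glickMap (pentagramMap^[k] A) (lift (pentagramMap^[k] A i)) 2 := by
    rw [hA.glickMap_iterate hn k]; rfl
  rw [h2, hk.glickMap_eq hn] at h1
  simp only [Finset.sum_apply, Pi.add_apply, Pi.smul_apply, lift_two, smul_eq_mul, mul_one] at h1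
  have hterm : ∀ j, 0 ≤ det3 (lift (pentagramMap^[k] A (j - 1))) (lift (pentagramMap^[k] A j))
      (lift (pentagramMap^[k] A i)) / det3 (lift (pentagramMap^[k] A (j - 1)))
        (lift (pentagramMap^[k] A j)) (lift (pentagramMap^[k] A (j + 1))) := fun j =>
    div_nonneg (hk.edge_nonneg' j i) (hk.ear_pos hn j).le
  have hterm' : ∀ j, 0 ≤ det3 (lift (pentagramMap^[k] A j)) (lift (pentagramMap^[k] A (j + 1)))
      (lift (pentagramMap^[k] A i)) / det3 (lift (pentagramMap^[k] A (j - 1)))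
        (lift (pentagramMap^[k] A j)) (lift (pentagramMap^[k] A (j + 1))) := fun j =>
    div_nonneg (hk.edge_nonneg j i) (hk.ear_pos hn j).le
  have h3 := (Finset.single_le_sum (fun j _ => add_nonneg (hterm' j) (hterm j))
    (Finset.mem_univ j)).trans h1
  rw [← div_le_iff₀ (hk.ear_pos hn j)]
  exact (le_add_of_nonneg_right (hterm j)).trans (h3.trans (le_max_right _ _))

/-- Oscillations of linear forms decay geometrically along the iterates. -/
theorem IsPositive.exists_oscillation_le (hA : IsPositive A) (hn : 5 ≤ n) :
    ∃ θ : ℝ, 0 ≤ θ ∧ θ < 1 ∧ ∀ l : (Fin 3 → ℝ) →ₗ[ℝ] ℝ, ∃ D : ℝ, ∀ (k : ℕ) (a b : ZMod n),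
      l (lift (pentagramMap^[k] A b)) - l (lift (pentagramMap^[k] A a)) ≤ D * θ ^ k := by
  obtain ⟨M, hM, hMA⟩ := hA.exists_shape_bound hn
  set R := M ^ (2 * n + 1) * (1 + M ^ (2 * n + 1)) with hR
  have hRpos : 0 < R := by positivity
  refine ⟨R / (R + 1), by positivity, by rw [div_lt_one (by positivity)]; linarith, fun l => ?_⟩
  obtain ⟨i, hi⟩ := Finite.exists_max fun i => l (lift (A i))
  obtain ⟨i', hi'⟩ := Finite.exists_min fun i => l (lift (A i))
  refine ⟨l (lift (A i)) - l (lift (A i')), fun k => ?_⟩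
  induction k with
  | zero => intro a b; simpa using sub_le_sub (hi b) (hi' a)
  | succ k ih =>
    intro a b
    rw [Function.iterate_succ_apply', pow_succ, ← mul_assoc, mul_comm _ (R / (R + 1))]
    have hk := hA.iterate hn k
    exact hk.oscillation_pentagramMap hn hRpos
      (fun j a b => hk.edge_pentagramMap_le hn hM (hMA k) j a b) l ih a b

/-- New values lie in the range of the old ones, so a step at vertex 0 is at most the current
oscillation: a geometric Cauchy sequence. The other vertices have the same limit because the
oscillation tends to 0. -/
theorem IsPositive.exists_tendsto_form (hA : IsPositive A) (hn : 5 ≤ n)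
    (l : (Fin 3 → ℝ) →ₗ[ℝ] ℝ) : ∃ x : ℝ, ∀ i,
      Tendsto (fun k => l (lift (pentagramMap^[k] A i))) atTop (𝓝 x) := by
  obtain ⟨θ, h0, h1, h⟩ := hA.exists_oscillation_le hn
  obtain ⟨D, hD⟩ := h l
  have hzero : Tendsto (fun k : ℕ => D * θ ^ k) atTop (𝓝 0) := by
    simpa using (tendsto_pow_atTop_nhds_zero_of_lt_one h0 h1).const_mul D
  have hdist : ∀ k, dist (l (lift (pentagramMap^[k] A 0))) (l (lift (pentagramMap^[k + 1] A 0)))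
      ≤ D * θ ^ k := by
    intro k
    have hk := hA.iterate hn k
    rw [Function.iterate_succ_apply', Real.dist_eq, abs_sub_le_iff]
    constructor
    · have := hk.le_form_pentagramMap hn l
        (c := l (lift (pentagramMap^[k] A 0)) - D * θ ^ k) (fun i => by linarith [hD k i 0]) 0
      linarith
    · have := hk.le_form_pentagramMap hn (-l)
        (c := -(l (lift (pentagramMap^[k] A 0)) + D * θ ^ k))
        (fun i => by simp only [LinearMap.neg_apply]; linarith [hD k 0 i]) 0
      simp only [LinearMap.neg_apply] at this
      linarith
  obtain ⟨x, hx⟩ := cauchySeq_tendsto_of_complete (cauchySeq_of_le_geometric θ D h1 hdist)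
  refine ⟨x, fun i => ?_⟩
  have hd : Tendsto (fun k => l (lift (pentagramMap^[k] A i)) - l (lift (pentagramMap^[k] A 0)))
      atTop (𝓝 0) := by
    refine squeeze_zero_norm (fun k => ?_) hzero
    rw [Real.norm_eq_abs, abs_sub_le_iff]
    exact ⟨hD k 0 i, hD k i 0⟩
  simpa using hd.add hx

/-- The iterates of the pentagram map shrink to a point. -/
theorem IsPositive.exists_tendsto (hA : IsPositive A) (hn : 5 ≤ n) : ∃ p : ℝ × ℝ, ∀ i,
    Tendsto (fun k => pentagramMap^[k] A i) atTop (𝓝 p) := by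
  obtain ⟨x, hx⟩ := hA.exists_tendsto_form hn (LinearMap.proj 0)
  obtain ⟨y, hy⟩ := hA.exists_tendsto_form hn (LinearMap.proj 1)
  exact ⟨(x, y), fun i => (hx i).prodMk_nhds (hy i)⟩

end Contraction

/-! ### The limit point as a simple eigenvector. -/

section Limit

variable {n : ℕ} [NeZero n] {A : ZMod n → ℝ × ℝ} {p : ℝ × ℝ}

theorem tendsto_form {s : ℕ → ℝ × ℝ} (hs : Tendsto s atTop (𝓝 p)) (l : (Fin 3 → ℝ) →ₗ[ℝ] ℝ) :
    Tendsto (fun k => l (lift (s k))) atTop (𝓝 (l (lift p))) := by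
  have hc : Continuous lift := by
    refine continuous_pi fun k => ?_
    fin_cases k
    · exact continuous_fst
    · exact continuous_snd
    · exact continuous_const
  exact ((l.continuous_of_finiteDimensional.comp hc).tendsto p).comp hs

theorem IsPositive.edge_limit_nonneg {n : ℕ} {A : ZMod n → ℝ × ℝ} (hA : IsPositive A) (hn : 5 ≤ n)
    (hp : ∀ i, Tendsto (fun k => pentagramMap^[k] A i) atTop (𝓝 p)) (j : ZMod n) :
    0 ≤ det3 (lift (A j)) (lift (A (j + 1))) (lift p) :=
  ge_of_tendsto' (tendsto_form (hp 0) (detForm (lift (A j)) (lift (A (j + 1)))))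
    fun k => hA.le_form_iterate hn _ (fun i => hA.edge_nonneg j i) k 0

/-- The limit point is fixed by Glick's operator. -/
theorem IsPositive.glickMap_limit (hA : IsPositive A) (hn : 5 ≤ n)
    (hp : ∀ i, Tendsto (fun k => pentagramMap^[k] A i) atTop (𝓝 p)) :
    glickMap A (lift p) = glickMap A (lift p) 2 • lift p := by
  have key : ∀ l : (Fin 3 → ℝ) →ₗ[ℝ] ℝ, l (glickMap A (lift p)) =
      glickMap A (lift p) 2 * l (lift p) := by
    intro l
    have hbound : ∀ e > 0, |l (glickMap A (lift p)) - glickMap A (lift p) 2 * l (lift p)| ≤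
        glickMap A (lift p) 2 * e := by
      intro e he
      have hev : ∀ᶠ k in atTop, ∀ i : ZMod n,
          |l (lift (pentagramMap^[k] A i)) - l (lift p)| < e := by
        rw [eventually_all]
        intro i
        have := (tendsto_form (hp i) l).eventually (Metric.ball_mem_nhds _ he)
        simpa [Real.dist_eq] using this
      obtain ⟨k, hk⟩ := hev.exists
      have hkA := hA.iterate hn k
      have hpk : ∀ i, Tendsto (fun m => pentagramMap^[m] (pentagramMap^[k] A) i) atTop (𝓝 p) := by
        intro i
        simp only [← Function.iterate_add_apply]
        exact (tendsto_add_atTop_iff_nat k).mpr (hp i)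
      have hn1 := hkA.edge_limit_nonneg hn hpk
      have hn2 : ∀ j, 0 ≤ det3 (lift (pentagramMap^[k] A (j - 1))) (lift (pentagramMap^[k] A j))
          (lift p) := fun j => by simpa using hn1 (j - 1)
      -- Passing to the iterate leaves the operator unchanged, while its vertices are now `e`-close
      -- to the limit under `l`. The coefficients are nonnegative and sum to the last coordinate.
      rw [← hA.glickMap_iterate hn k, hkA.glickMap_eq hn]
      generalize pentagramMap^[k] A = C at *
      have ht := fun j => (hkA.ear_pos hn j).le
      simp only [map_sum, map_add, map_smul, smul_eq_mul, Finset.sum_apply, Pi.add_apply,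
        Pi.smul_apply, lift_two, mul_one, Finset.sum_mul]
      rw [← Finset.sum_sub_distrib]
      refine (Finset.abs_sum_le_sum_abs _ _).trans (Finset.sum_le_sum fun j _ => ?_)
      have c1 := div_nonneg (hn1 j) (ht j)
      have c2 := div_nonneg (hn2 j) (ht j)
      have b1 := abs_lt.mp (hk (j - 1))
      have b2 := abs_lt.mp (hk (j + 1))
      generalize det3 (lift (C j)) (lift (C (j + 1))) (lift p) /
        det3 (lift (C (j - 1))) (lift (C j)) (lift (C (j + 1))) = x at *
      generalize det3 (lift (C (j - 1))) (lift (C j)) (lift p) /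
        det3 (lift (C (j - 1))) (lift (C j)) (lift (C (j + 1))) = y at *
      have m1 := mul_le_mul_of_nonneg_left b1.1.le c1
      have m2 := mul_le_mul_of_nonneg_left b1.2.le c1
      have m3 := mul_le_mul_of_nonneg_left b2.1.le c2
      have m4 := mul_le_mul_of_nonneg_left b2.2.le c2
      rw [abs_le]
      constructor <;> linarith
    have hlim : Tendsto (fun e : ℝ => glickMap A (lift p) 2 * e) (𝓝[>] 0) (𝓝 0) := by
      have : Tendsto (fun e : ℝ => glickMap A (lift p) 2 * e) (𝓝 0) (𝓝 (glickMap A (lift p) 2 * 0)) :=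
        tendsto_id.const_mul _
      rw [mul_zero] at this
      exact this.mono_left nhdsWithin_le_nhds
    have h0 : |l (glickMap A (lift p)) - glickMap A (lift p) 2 * l (lift p)| ≤ 0 :=
      ge_of_tendsto hlim (eventually_nhdsWithin_of_forall fun e he => hbound e he)
    exact sub_eq_zero.mp (abs_eq_zero.mp (le_antisymm h0 (abs_nonneg _)))
  ext k
  simpa using key (LinearMap.proj k)

/-- Glick's operator is strictly positive: an eigenvector in the cone over the polygon lies in its
interior. -/
theorem IsPositive.eq_zero_of_edge_eq_zero (hA : IsPositive A) (hn : 5 ≤ n) {v : Fin 3 → ℝ} {c : ℝ}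
    (hv : ∀ j, 0 ≤ det3 (lift (A j)) (lift (A (j + 1))) v) (he : glickMap A v = c • v) {i : ZMod n}
    (hi : det3 (lift (A i)) (lift (A (i + 1))) v = 0) : v = 0 := by
  obtain ⟨k1, k2, k3, k4⟩ := small_ne_zero hn
  have hv' : ∀ j, 0 ≤ det3 (lift (A (j - 1))) (lift (A j)) v := fun j => by
    simpa using hv (j - 1)
  have h := congrArg (detForm (lift (A i)) (lift (A (i + 1)))) he
  rw [hA.glickMap_eq hn] at h
  simp only [map_sum, map_add, map_smul, smul_eq_mul, detForm_apply, hi, mul_zero] at h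
  have hx : ∀ j, 0 ≤ det3 (lift (A j)) (lift (A (j + 1))) v /
      det3 (lift (A (j - 1))) (lift (A j)) (lift (A (j + 1))) *
        det3 (lift (A i)) (lift (A (i + 1))) (lift (A (j - 1))) := fun j =>
    mul_nonneg (div_nonneg (hv j) (hA.ear_pos hn j).le) (hA.edge_nonneg _ _)
  have hy : ∀ j, 0 ≤ det3 (lift (A (j - 1))) (lift (A j)) v /
      det3 (lift (A (j - 1))) (lift (A j)) (lift (A (j + 1))) *
        det3 (lift (A i)) (lift (A (i + 1))) (lift (A (j + 1))) := fun j =>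
    mul_nonneg (div_nonneg (hv' j) (hA.ear_pos hn j).le) (hA.edge_nonneg _ _)
  rw [Finset.sum_eq_zero_iff_of_nonneg (fun j _ => add_nonneg (hx j) (hy j))] at h
  have h0 : ∀ j, det3 (lift (A j)) (lift (A (j + 1))) v = 0 := by
    intro j
    -- The height of `v` over side `j` multiplies `A (j - 1)` in term `j` and `A (j + 2)` in term `j
    -- + 1`. At least one of these vertices is off side `i`; this is where `4 ≠ 0` in `ZMod n`
    -- enters.
    by_cases hj : j - 1 = i ∨ j - 1 = i + 1
    · have hs := h (j + 1) (Finset.mem_univ _)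
      have z := ((add_eq_zero_iff_of_nonneg (hx _) (hy _)).mp hs).2
      rw [add_sub_cancel_right] at z
      have hpos : 0 < det3 (lift (A i)) (lift (A (i + 1))) (lift (A (j + 1 + 1))) := by
        apply hA
        · intro h'
          rcases hj with hj | hj
          · exact k3 (by linear_combination h' - hj)
          · exact k4 (by linear_combination h' - hj)
        · intro h'
          rcases hj with hj | hj
          · exact k2 (by linear_combination h' - hj)
          · exact k3 (by linear_combination h' - hj)
      have z' := (mul_eq_zero.mp z).resolve_right hpos.ne'
      refine (div_eq_zero_iff.mp z').resolve_right ?_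
      have := (hA.ear_pos hn (j + 1)).ne'
      rwa [add_sub_cancel_right] at this
    · push Not at hj
      have hs := h j (Finset.mem_univ _)
      have z := ((add_eq_zero_iff_of_nonneg (hx _) (hy _)).mp hs).1
      have z' := (mul_eq_zero.mp z).resolve_right (hA _ _ hj.1 hj.2).ne'
      exact (div_eq_zero_iff.mp z').resolve_right (hA.ear_pos hn j).ne'
  have hd : det3 (lift (A (i + 1))) (lift (A (i + 2))) v = 0 := by
    have := h0 (i + 1)
    rwa [add_assoc, one_add_one_eq_two] at this
  -- Vanishing on sides `i` and `i + 1` makes `v` a multiple of their common vertex, and side `i +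
  -- 2` misses that vertex.
  have hcr := det3_smul_eq (lift (A i)) (lift (A (i + 1))) (lift (A (i + 2))) v
  rw [hd, hi, zero_smul, zero_smul, zero_add, add_zero] at hcr
  have hc2 := congrArg (detForm (lift (A (i + 2))) (lift (A (i + 2 + 1)))) hcr
  simp only [map_smul, detForm_apply, h0, smul_eq_mul, mul_zero] at hc2
  have hpos : 0 < det3 (lift (A (i + 2))) (lift (A (i + 2 + 1))) (lift (A (i + 1))) :=
    hA _ _ (fun h => k1 (by linear_combination -h)) (fun h => k2 (by linear_combination -h))
  have hm := (mul_eq_zero.mp hc2.symm).resolve_right hpos.ne'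
  rw [hm, zero_smul] at hcr
  exact (smul_eq_zero.mp hcr).resolve_left (hA.ear_pos' hn i).ne'

/-- The eigenspace that contains a point of the cone over the polygon is a line. -/
theorem IsPositive.eigenvector_unique (hA : IsPositive A) (hn : 5 ≤ n) {c : ℝ}
    (hp : ∀ j, 0 ≤ det3 (lift (A j)) (lift (A (j + 1))) (lift p))
    (he : glickMap A (lift p) = c • lift p) {w : Fin 3 → ℝ} (hw : glickMap A w = c • w) :
    w = w 2 • lift p := by
  have hpne : lift p ≠ 0 := fun h => by simpa using congrFun h 2
  have hpos : ∀ j, 0 < det3 (lift (A j)) (lift (A (j + 1))) (lift p) := fun j =>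
    (hp j).lt_of_ne fun h => hpne (hA.eq_zero_of_edge_eq_zero hn hp he h.symm)
  -- If some height is negative, subtract the smallest ratio `r` times the limit vector: the result
  -- is an eigenvector in the cone touching its boundary, hence 0, yet its last coordinate is `-r`,
  -- not 0. Applied to `y` and `-y`, this forces `y = 0`.
  have main : ∀ y : Fin 3 → ℝ, glickMap A y = c • y → y 2 = 0 →
      ∀ j, 0 ≤ det3 (lift (A j)) (lift (A (j + 1))) y := by
    intro y hy hy2
    by_contra! hneg
    obtain ⟨j₀, hj₀⟩ := hneg
    obtain ⟨j, hj⟩ := Finite.exists_min fun j => det3 (lift (A j)) (lift (A (j + 1))) y /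
      det3 (lift (A j)) (lift (A (j + 1))) (lift p)
    set r := det3 (lift (A j)) (lift (A (j + 1))) y /
      det3 (lift (A j)) (lift (A (j + 1))) (lift p) with hr
    have hr0 : r < 0 := (hj j₀).trans_lt (div_neg_of_neg_of_pos hj₀ (hpos j₀))
    have hz : ∀ i, det3 (lift (A i)) (lift (A (i + 1))) (y + (-r) • lift p) =
        det3 (lift (A i)) (lift (A (i + 1))) y
          - r * det3 (lift (A i)) (lift (A (i + 1))) (lift p) := by
      intro i
      rw [← detForm_apply, map_add, map_smul]
      simp only [detForm_apply, smul_eq_mul]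
      ring
    have h0 := hA.eq_zero_of_edge_eq_zero hn (v := y + (-r) • lift p) (c := c) (i := j)
      (fun i => by
        rw [hz, sub_nonneg, ← le_div_iff₀ (hpos i)]
        exact hj i)
      (by rw [map_add, map_smul, hy, he, smul_add, smul_comm])
      (by rw [hz, hr, div_mul_cancel₀ _ (hpos j).ne', sub_self])
    have := congrFun h0 2
    simp [hy2] at this
    exact hr0.ne this
  set y := w - w 2 • lift p with hy
  have hye : glickMap A y = c • y := by
    rw [hy, map_sub, map_smul, hw, he, smul_sub, smul_comm]
  have hy2 : y 2 = 0 := by simp [hy]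
  have g1 := main y hye hy2
  have g2 := main (-y) (by rw [map_neg, hye, smul_neg]) (by simp [hy2]) 0
  rw [← detForm_apply, map_neg, detForm_apply] at g2
  have := hA.eq_zero_of_edge_eq_zero hn g1 hye (i := 0) (le_antisymm (by linarith) (g1 0))
  exact sub_eq_zero.mp this

end Limit


/-! ### Clockwise polygons, by exchanging the two coordinates. -/

section Reflection

variable {n : ℕ}

theorem lift_swap (p : ℝ × ℝ) : lift p.swap = lift p ∘ Equiv.swap 0 1 := by
  ext k
  fin_cases k <;> simp [lift, Equiv.swap_apply_def]

theorem det3_comp_swap (a b c : Fin 3 → ℝ) :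
    det3 (a ∘ Equiv.swap 0 1) (b ∘ Equiv.swap 0 1) (c ∘ Equiv.swap 0 1) = -det3 a b c := by
  simp [det3_eq, Equiv.swap_apply_def]
  ring

theorem pentagramMap_swap (A : ZMod n → ℝ × ℝ) :
    pentagramMap (Prod.swap ∘ A) = Prod.swap ∘ pentagramMap A := by
  funext i
  simp only [pentagramMap, lineInter, Function.comp_apply, orient, lift_swap, det3_comp_swap]
  have h : ∀ x y : ℝ, -x / (-x - -y) = x / (x - y) := fun x y => by
    rw [neg_sub_neg, ← neg_sub, neg_div_neg_eq]
  rw [h]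
  ext <;> simp [AffineMap.lineMap_apply]

theorem iterate_pentagramMap_swap (A : ZMod n → ℝ × ℝ) (k : ℕ) :
    pentagramMap^[k] (Prod.swap ∘ A) = Prod.swap ∘ pentagramMap^[k] A := by
  induction k with
  | zero => rfl
  | succ k ih => rw [Function.iterate_succ_apply', ih, pentagramMap_swap,
      Function.iterate_succ_apply']

/-- The reflection negates every determinant, and only ratios of determinants occur. -/
theorem glickMap_swap [NeZero n] (A : ZMod n → ℝ × ℝ) (v : Fin 3 → ℝ) :
    glickMap (Prod.swap ∘ A) (v ∘ Equiv.swap 0 1) = glickMap A v ∘ Equiv.swap 0 1 := by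
  simp only [glickMap_apply, Function.comp_apply, lift_swap, det3_comp_swap, neg_div_neg_eq]
  ext k
  simp

theorem isPositive_or_swap {A : ZMod n → ℝ × ℝ} (hA : IsConvexPolygon A) :
    IsPositive A ∨ IsPositive (Prod.swap ∘ A) := by
  refine hA.imp id fun h i j hi hj => ?_
  simp only [Function.comp_apply, lift_swap, det3_comp_swap]
  exact neg_pos.mpr (h i j hi hj)

end Reflection

/-! ### Field of definition of an eigenvector. -/

section Field

/-- A real eigenvector with last coordinate `1` that spans its eigenspace is defined over the field
generated by the eigenvalue. -/
theorem eigenvector_mem_adjoin {k L : Type*} [Field k] [Field L] [Algebra k L]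
    (N : Matrix (Fin 3) (Fin 3) k) {c : L} {v : Fin 3 → L} (hv2 : v 2 = 1)
    (hv : (N.map (algebraMap k L)).mulVec v = c • v)
    (huniq : ∀ w, (N.map (algebraMap k L)).mulVec w = c • w → w = w 2 • v) :
    FiniteDimensional k (IntermediateField.adjoin k {c}) ∧
      Module.finrank k (IntermediateField.adjoin k {c}) ≤ 3 ∧
      ∀ i, v i ∈ IntermediateField.adjoin k {c} := by
  have hvne : v ≠ 0 := fun h => by simp [h] at hv2
  have hdet : (Matrix.scalar (Fin 3) c - N.map (algebraMap k L)).det = 0 := by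
    refine Matrix.exists_mulVec_eq_zero_iff.mp ⟨v, hvne, ?_⟩
    rw [Matrix.sub_mulVec, hv, Matrix.scalar_apply, ← Matrix.smul_one_eq_diagonal,
      Matrix.smul_mulVec, Matrix.one_mulVec, sub_self]
  have hroot : Polynomial.aeval c N.charpoly = 0 := by
    rw [Polynomial.aeval_def, ← Polynomial.eval_map, ← Matrix.charpoly_map, Matrix.eval_charpoly]
    exact hdet
  have hint : IsIntegral k c := ⟨N.charpoly, N.charpoly_monic, hroot⟩
  refine ⟨IntermediateField.adjoin.finiteDimensional hint, ?_, ?_⟩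
  · rw [IntermediateField.adjoin.finrank hint]
    refine (Polynomial.natDegree_le_of_dvd (minpoly.dvd k c hroot)
      N.charpoly_monic.ne_zero).trans ?_
    simp [Matrix.charpoly_natDegree_eq_dim]
  · set F := IntermediateField.adjoin k {c}
    set cF : F := ⟨c, IntermediateField.mem_adjoin_simple_self k c⟩
    have hmap : (Matrix.scalar (Fin 3) cF - N.map (algebraMap k F)).map (algebraMap F L) =
        Matrix.scalar (Fin 3) c - N.map (algebraMap k L) := by
      ext i j
      simp only [Matrix.map_apply, Matrix.sub_apply, map_sub, Matrix.scalar_apply,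
        Matrix.diagonal_apply, ← IsScalarTower.algebraMap_apply]
      split_ifs <;> simp [cF]
    -- The determinant already vanishes over `F`, so there is a kernel vector with entries in `F`.
    -- Uniqueness makes it proportional to `v`, and dividing by its last entry gives `v`.
    have hdetF : (Matrix.scalar (Fin 3) cF - N.map (algebraMap k F)).det = 0 := by
      apply (algebraMap F L).injective
      rw [RingHom.map_det, RingHom.mapMatrix_apply, hmap, hdet, map_zero]
    obtain ⟨w, hw0, hw⟩ := Matrix.exists_mulVec_eq_zero_iff.mpr hdetF
    have hwL : (Matrix.scalar (Fin 3) c - N.map (algebraMap k L)).mulVec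
        (fun i => algebraMap F L (w i)) = 0 := by
      rw [← hmap]
      ext i
      have := congrArg (algebraMap F L) (congrFun hw i)
      rw [RingHom.map_mulVec] at this
      exact this.trans (map_zero _)
    rw [Matrix.sub_mulVec, Matrix.scalar_apply, ← Matrix.smul_one_eq_diagonal,
      Matrix.smul_mulVec, Matrix.one_mulVec, sub_eq_zero] at hwL
    have hspan := huniq _ hwL.symm
    have hw2 : w 2 ≠ 0 := by
      intro h
      apply hw0
      ext i
      have := congrFun hspan i
      simpa [h] using this
    intro i
    have hi := congrFun hspan i
    simp only [Pi.smul_apply, smul_eq_mul] at hi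
    have hne : algebraMap F L (w 2) ≠ 0 := by simpa using hw2
    have : v i = algebraMap F L (w i / w 2) := by
      rw [map_div₀, hi, mul_div_cancel_left₀ _ hne]
    rw [this]
    exact (w i / w 2).2

end Field

/-! ### Both orientations, and the matrix over the coordinate field. -/

section Main

variable {n : ℕ} [NeZero n] {A : ZMod n → ℝ × ℝ}

theorem IsPositive.exists_limit (hA : IsPositive A) (hn : 5 ≤ n) :
    ∃ p : ℝ × ℝ, (∀ i, Tendsto (fun k => pentagramMap^[k] A i) atTop (𝓝 p)) ∧
      ∃ c : ℝ, glickMap A (lift p) = c • lift p ∧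
        ∀ w, glickMap A w = c • w → w = w 2 • lift p := by
  obtain ⟨p, hp⟩ := hA.exists_tendsto hn
  have he := hA.glickMap_limit hn hp
  exact ⟨p, hp, _, he, fun w hw =>
    hA.eigenvector_unique hn (hA.edge_limit_nonneg hn hp) he hw⟩

theorem IsConvexPolygon.exists_limit (hA : IsConvexPolygon A) (hn : 5 ≤ n) :
    ∃ p : ℝ × ℝ, (∀ i, Tendsto (fun k => pentagramMap^[k] A i) atTop (𝓝 p)) ∧
      ∃ c : ℝ, glickMap A (lift p) = c • lift p ∧
        ∀ w, glickMap A w = c • w → w = w 2 • lift p := by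
  rcases isPositive_or_swap hA with h | h
  · exact h.exists_limit hn
  obtain ⟨p, hp, c, hc, hu⟩ := h.exists_limit hn
  have hAA : Prod.swap ∘ (Prod.swap ∘ A) = A := by
    funext i; simp
  have hee : ∀ w : Fin 3 → ℝ, (w ∘ Equiv.swap 0 1) ∘ Equiv.swap (0 : Fin 3) 1 = w := by
    intro w; funext i; simp
  refine ⟨p.swap, fun i => ?_, c, ?_, fun w hw => ?_⟩
  · have := (continuous_swap.tendsto p).comp (hp i)
    refine this.congr fun k => ?_
    simp [iterate_pentagramMap_swap]
  · have := glickMap_swap (Prod.swap ∘ A) (lift p)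
    rw [hAA, ← lift_swap, hc] at this
    rw [this, lift_swap]
    rfl
  · have h1 := hu (w ∘ Equiv.swap 0 1) (by rw [glickMap_swap, hw]; rfl)
    have h2 := congrArg (· ∘ Equiv.swap (0 : Fin 3) 1) h1
    simp only [hee] at h2
    rw [lift_swap]
    exact h2

theorem lift_mem_coordField {n : ℕ} (A : ZMod n → ℝ × ℝ) (i : ZMod n) (k : Fin 3) :
    lift (A i) k ∈ coordField A := by
  fin_cases k
  · exact IntermediateField.subset_adjoin _ _ (Or.inl ⟨i, rfl⟩)
  · exact IntermediateField.subset_adjoin _ _ (Or.inr ⟨i, rfl⟩)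
  · exact one_mem _

theorem glickMatrix_mem_coordField (A : ZMod n → ℝ × ℝ) (i j : Fin 3) :
    glickMatrix A i j ∈ coordField A := by
  have hdet : ∀ a b c : Fin 3 → ℝ, (∀ k, a k ∈ coordField A) → (∀ k, b k ∈ coordField A) →
      (∀ k, c k ∈ coordField A) → det3 a b c ∈ coordField A := by
    intro a b c ha hb hc
    rw [det3_eq]
    exact add_mem (sub_mem
      (mul_mem (ha _) (sub_mem (mul_mem (hb _) (hc _)) (mul_mem (hb _) (hc _))))
      (mul_mem (ha _) (sub_mem (mul_mem (hb _) (hc _)) (mul_mem (hb _) (hc _)))))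
      (mul_mem (ha _) (sub_mem (mul_mem (hb _) (hc _)) (mul_mem (hb _) (hc _))))
  have hsingle : ∀ k, (Pi.single j (1 : ℝ) : Fin 3 → ℝ) k ∈ coordField A := by
    intro k
    rw [Pi.single_apply]
    split_ifs
    · exact one_mem _
    · exact zero_mem _
  rw [glickMatrix, LinearMap.toMatrix'_apply, glickMap_apply]
  simp only [Pi.sub_apply, Pi.smul_apply, Finset.sum_apply, smul_eq_mul]
  have hl := lift_mem_coordField A
  exact sub_mem (mul_mem (natCast_mem _ n) (hsingle i)) (sum_mem fun m _ =>
    mul_mem (div_mem (hdet _ _ _ (hl _) hsingle (hl _)) (hdet _ _ _ (hl _) (hl _) (hl _))) (hl _ _))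

end Main

end Pentagram

theorem theorem1 (n : ℕ) [NeZero n] (hn : 5 ≤ n) (A : ZMod n → ℝ × ℝ)
    (hA : Pentagram.IsConvexPolygon A) :
    ∃ X Y : ℝ,
      (∀ i : ZMod n, Filter.Tendsto (fun k : ℕ => (Pentagram.pentagramMap^[k] A) i)
        Filter.atTop (nhds (X, Y))) ∧
      ∃ lam : ℝ,
        Module.End.HasEigenvector (Matrix.toLin' (Pentagram.glickMatrix A)) lam
          (Pentagram.lift (X, Y)) ∧
        FiniteDimensional (Pentagram.coordField A)
          (IntermediateField.adjoin (Pentagram.coordField A) {lam}) ∧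
        Module.finrank (Pentagram.coordField A)
          (IntermediateField.adjoin (Pentagram.coordField A) {lam}) ≤ 3 ∧
        X ∈ IntermediateField.adjoin (Pentagram.coordField A) {lam} ∧
        Y ∈ IntermediateField.adjoin (Pentagram.coordField A) {lam} := by
  obtain ⟨⟨X, Y⟩, hp, c, hc, hu⟩ := hA.exists_limit hn
  refine ⟨X, Y, hp, c, ?_, ?_⟩
  · rw [Pentagram.glickMatrix, Matrix.toLin'_toMatrix', Module.End.hasEigenvector_iff,
      Module.End.mem_eigenspace_iff]
    exact ⟨hc, fun h => by simpa using congrFun h 2⟩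
  · let N : Matrix (Fin 3) (Fin 3) (Pentagram.coordField A) := Matrix.of fun i j =>
      ⟨Pentagram.glickMatrix A i j, Pentagram.glickMatrix_mem_coordField A i j⟩
    have hN : N.map (algebraMap (Pentagram.coordField A) ℝ) = Pentagram.glickMatrix A := rfl
    have hmul : ∀ w, (N.map (algebraMap (Pentagram.coordField A) ℝ)).mulVec w =
        Pentagram.glickMap A w := by
      intro w
      rw [hN, Pentagram.glickMatrix, LinearMap.toMatrix'_mulVec]
    obtain ⟨h1, h2, h3⟩ := Pentagram.eigenvector_mem_adjoin N (c := c)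
      (v := Pentagram.lift (X, Y)) rfl (by rw [hmul, hc])
      (fun w hw => hu w (by rw [← hmul, hw]))
    exact ⟨h1, h2, h3 0, h3 1⟩
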